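/- All graphs are finite and simple; the diameter of a disconnected graph is $\infty$. A graph is outerplanar if it can be drawn without crossings in a closed disc, edges being drawn as arcs, with all its vertices on the boundary circle of the disc. A completion of a graph $G$ is a graph on the same vertex set containing all edges of $G$, and $\mathbf{opdi}(G)$ denotes the minimum diameter of an outerplanar completion of $G$ (with $\mathbf{opdi}(G)=\infty$ if there is none). For a family $X$ of graphs and $i\in\mathbb{N}$, let $iX$ be the family of all disjoint unions of $i$ (not necessarily distinct) graphs of $X$, and let $\operatorname{join}(v,iX)$ be the family of all graphs obtained by taking $i$ graphs of $X$ and a new vertex $v$ and connecting each of the $i$ graphs to $v$ by a single edge (ending at an arbitrary vertex of that graph). Define families $A_i$ ($i\ge 0$) and $B_i$ ($i\ge 0$) by $$A_0=\{2K_1\},\qquad A_i=\begin{cases}2B_{i-1} & \text{if } i\ge 1 \text{ is even},\\ 2A_{i-1} & \text{if } i \text{ is odd},\end{cases}$$ $$B_1=\{K_{1,3}\},\qquad B_i=\begin{cases}\emptyset & \text{if } i \text{ is even},\\ \operatorname{join}(v,3B_{i-2}) & \text{if } i\ge 3 \text{ is odd}.\end{cases}$$ **Theorem.** Let $D\in\mathbb{N}=\{0,1,2,\dots\}$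 and let $G$ be an outerplanar graph that contains a graph from $A_D\cup B_D$ as a minor. Then $G$ has diameter at least $D+1$, and moreover $\mathbf{opdi}(G)>D$. In particular, every graph $H\in A_D\cup B_D$ satisfies $\mathbf{opdi}(H)>D$, that is, $H$ is a diameter-$D$ obstruction. -/

import Mathlib

namespace OPDI

/-- An outerplanar drawing of `G`: a drawing in the closed unit disc of the plane, without
crossings, in which all vertices lie on the bounding circle (hence on the outer face). Every edge
is drawn as an arc, i.e. an injective continuous curve joining its two ends; an arc passes through
no other vertex, and two arcs meet at most in a common end. -/
structure OuterplanarDrawing {V : Type*} (G : SimpleGraph V) where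
  /-- the point at which a vertex is drawn -/
  pos : V → ℂ
  /-- the point set of the curve that draws an edge (irrelevant off the edge set) -/
  arc : Sym2 V → Set ℂ
  pos_injective : Function.Injective pos
  pos_mem : ∀ v, pos v ∈ Metric.sphere (0 : ℂ) 1
  arc_subset : ∀ e ∈ G.edgeSet, arc e ⊆ Metric.closedBall (0 : ℂ) 1
  exists_path : ∀ u v, G.Adj u v →
    ∃ γ : Path (pos u) (pos v), Function.Injective γ ∧ Set.range γ = arc s(u, v)
  mem_of_pos_mem : ∀ e ∈ G.edgeSet, ∀ w, pos w ∈ arc e → w ∈ e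
  inter_subset : ∀ e ∈ G.edgeSet, ∀ e' ∈ G.edgeSet, e ≠ e' →
    ∀ z ∈ arc e ∩ arc e', ∃ w, w ∈ e ∧ w ∈ e' ∧ pos w = z

/-- A graph is outerplanar if it has an outerplanar drawing. -/
def IsOuterplanar {V : Type*} (G : SimpleGraph V) : Prop :=
  Nonempty (OuterplanarDrawing G)

/-- `H` is a minor of `G`: there are pairwise disjoint, (nonempty) connected branch sets in `G`,
one for each vertex of `H`, with an edge of `G` between the branch sets of any two adjacent
vertices of `H`. -/
def IsMinor {W V : Type*} (H : SimpleGraph W) (G : SimpleGraph V) : Prop :=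
  ∃ β : W → Set V,
    (∀ w, (G.induce (β w)).Connected) ∧
    (∀ w w', w ≠ w' → Disjoint (β w) (β w')) ∧
    (∀ w w', H.Adj w w' → ∃ x ∈ β w, ∃ y ∈ β w', G.Adj x y)

/-- `opdi G`: the least diameter of an outerplanar completion of `G`, a completion being a graph
on the same vertex set that contains all edges of `G`. The diameter of a disconnected graph
is infinite. -/
noncomputable def opdi {V : Type*} (G : SimpleGraph V) : ℕ∞ :=
  sInf {d : ℕ∞ | ∃ G' : SimpleGraph V, G ≤ G' ∧ IsOuterplanar G' ∧ G'.ediam = d}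

/-- A graph together with its vertex type. -/
structure Gr where
  V : Type
  graph : SimpleGraph V

/-- The disjoint union of a family of graphs. -/
def disjointUnion {i : ℕ} (F : Fin i → Gr) : Gr where
  V := Σ j, (F j).V
  graph :=
    { Adj := fun x y => ∃ (j : Fin i) (a b : (F j).V),
        x = ⟨j, a⟩ ∧ y = ⟨j, b⟩ ∧ (F j).graph.Adj a b
      symm := ⟨by
        rintro _ _ ⟨j, a, b, rfl, rfl, h⟩
        exact ⟨j, b, a, rfl, rfl, h.symm⟩⟩
      loopless := ⟨by
        rintro _ ⟨j, a, b, rfl, h, hab⟩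
        obtain rfl : a = b := by simpa using h
        exact hab.ne rfl⟩ }

/-- The disjoint union of the graphs `F j` and a new vertex `v = none`, with one further edge for
each `j`, which joins `v` to the vertex `a j` of the `j`-th graph. -/
def joinVertex {i : ℕ} (F : Fin i → Gr) (a : ∀ j, (F j).V) : Gr where
  V := Option (disjointUnion F).V
  graph :=
    { Adj := fun x y =>
        (∃ p q, x = some p ∧ y = some q ∧ (disjointUnion F).graph.Adj p q) ∨
        (∃ j, x = none ∧ y = some ⟨j, a j⟩) ∨
        (∃ j, x = some ⟨j, a j⟩ ∧ y = none)
      symm := ⟨by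
        rintro _ _ (⟨p, q, rfl, rfl, h⟩ | ⟨j, rfl, rfl⟩ | ⟨j, rfl, rfl⟩)
        · exact Or.inl ⟨q, p, rfl, rfl, h.symm⟩
        · exact Or.inr (Or.inr ⟨j, rfl, rfl⟩)
        · exact Or.inr (Or.inl ⟨j, rfl, rfl⟩)⟩
      loopless := ⟨by
        rintro _ (⟨p, q, rfl, h, hpq⟩ | ⟨j, rfl, h⟩ | ⟨j, rfl, h⟩)
        · obtain rfl : p = q := by simpa using h
          exact hpq.ne rfl
        · cases h
        · cases h⟩ }

/-- `iX`: the disjoint unions of `i` (not necessarily distinct) graphs of the family `X`. -/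
def copies (i : ℕ) (X : Set Gr) : Set Gr :=
  {K | ∃ F : Fin i → Gr, (∀ j, F j ∈ X) ∧ K = disjointUnion F}

/-- `join(v, iX)`: all graphs obtained from `i` graphs of the family `X` and a new vertex `v` by
connecting each of the `i` graphs to `v` by a single edge. -/
def joinCopies (i : ℕ) (X : Set Gr) : Set Gr :=
  {K | ∃ (F : Fin i → Gr) (a : ∀ j, (F j).V), (∀ j, F j ∈ X) ∧ K = joinVertex F a}

/-- The edgeless graph on two vertices. -/
def twoK1 : Gr := ⟨Fin 2, ⊥⟩

/-- The star with three leaves. -/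
def K13 : Gr := ⟨Fin 1 ⊕ Fin 3, completeBipartiteGraph (Fin 1) (Fin 3)⟩

/-- The families `B_i`. -/
def famB : ℕ → Set Gr
  | 0 => ∅
  | 1 => {K13}
  | i + 2 => if 2 ∣ i + 2 then ∅ else joinCopies 3 (famB i)

/-- The families `A_i`. -/
def famA : ℕ → Set Gr
  | 0 => {twoK1}
  | i + 1 => if 2 ∣ i + 1 then copies 2 (famB i) else copies 2 (famA i)

end OPDI

/-!
An outerplanar drawing, its bounding circle cut open at a point, orders the vertices linearly, and
no edge of the graph interlaces with another: seen from the ends of one arc and of another, two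
disjoint curves would sweep angles that contradict the inscribed angle theorem. Hence two disjoint
connected sets do not interlace either, and each of them lies on one side of the other.

The branch sets of a minor in `B_{2k-1}` form a ternary tree of height `k`. If `X` is the union of
such a tree (of a single connected set, for `k = 0`) then, for every vertex `o`, some vertex has
distance at least `k + 1` from all vertices on the side of `X` on which `o` lies. For two disjoint
sets of this kind, every vertex lies on the side of one on which the other lies, so the two far
vertices are at distance at least `2k + 1`. This is `2k + 2` if a third connected set separates the
two, as every walk between the far vertices then meets that set. In a ternary tree of height
`k + 1`, the root together with a suitable child separates the other two children. Of four disjoint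
sets, either one separates two others or, after a suitable pairing of the four far vertices, the
two walks that join them in pairs meet, in a vertex that is remote from at least three of the four.
-/

namespace OPDI

open Set
open scoped Function

section ChordsOfTheDisc

open Complex

lemma one_sub_mem_slitPlane {z : ℂ} (hz : ‖z‖ ≤ 1) (hz1 : z ≠ 1) : 1 - z ∈ slitPlane := by
  rw [mem_slitPlane_iff]
  by_contra! h
  have him : z.im = 0 := by simpa using h.2
  have hre : 1 ≤ z.re := by simpa using h.1
  exact hz1 (Complex.ext (le_antisymm ((re_le_norm z).trans hz) hre) him)

lemma arg_one_sub_exp {θ : ℝ} (h₀ : 0 < θ) (h₁ : θ < 2 * Real.pi) :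
    arg (1 - exp (θ * I)) = (θ - Real.pi) / 2 := by
  have hsin : 0 < 2 * Real.sin (θ / 2) :=
    mul_pos two_pos (Real.sin_pos_of_pos_of_lt_pi (by linarith) (by linarith))
  have hpolar : 1 - exp (θ * I) = (2 * Real.sin (θ / 2) : ℝ) *
      (cos ((θ - Real.pi) / 2 : ℝ) + sin ((θ - Real.pi) / 2 : ℝ) * I) := by
    have hθ : (θ : ℂ) = 2 * (θ / 2 : ℝ) := by push_cast; ring
    have hψ : (θ - Real.pi) / 2 = θ / 2 - Real.pi / 2 := by ring
    rw [hψ, ← ofReal_cos, ← ofReal_sin, Real.cos_sub_pi_div_two, Real.sin_sub_pi_div_two, exp_mul_I,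
      hθ, cos_two_mul, sin_two_mul]
    push_cast
    linear_combination -2 * sin_sq_add_cos_sq (θ / 2 : ℂ)
  rw [hpolar, arg_mul_cos_add_sin_mul_I hsin ⟨by linarith, by linarith⟩]

lemma sub_eq_log_sub_log_of_exp_eq {X : Type*} [TopologicalSpace X] [PreconnectedSpace X]
    {L g : X → ℂ} {c : ℂ} (hL : Continuous L) (hg : Continuous g) (hslit : ∀ x, g x ∈ slitPlane)
    (hexp : ∀ x, exp (L x) = c * g x) (x y : X) : L y - L x = log (g y) - log (g x) := by
  have hconst : ∀ z, exp (L z - log (g z)) = c := fun z ↦ by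
    rw [exp_sub, hexp, exp_log (slitPlane_ne_zero (hslit z)),
      mul_div_cancel_right₀ _ (slitPlane_ne_zero (hslit z))]
  have hdiff : (fun z ↦ L z - log (g z)) = fun _ ↦ L x - log (g x) :=
    isCoveringMap_exp.eq_of_comp_eq (hL.sub (hg.clog hslit)) continuous_const
      (funext fun z ↦ Subtype.ext ((hconst z).trans (hconst x).symm)) x rfl
  linear_combination congrFun hdiff y

/-- The inscribed angle theorem, for curves: `(L 1 - L 0).im` is the angle that `δ` sweeps when seen
from the point `exp (θ * I)`. -/
lemma im_sub_eq_half_sub_of_exp_eq {θ φ φ' : ℝ} {c : ℂ} {L δ : ℝ → ℂ} (hL : Continuous L)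
    (hδ : Continuous δ) (hexp : ∀ t, exp (L t) = c * (exp (θ * I) - δ t)) (hle : ∀ t, ‖δ t‖ ≤ 1)
    (hne : ∀ t, δ t ≠ exp (θ * I)) (hδ₀ : δ 0 = exp (φ * I)) (hδ₁ : δ 1 = exp (φ' * I))
    (hφ : φ ∈ Ioo θ (θ + 2 * Real.pi)) (hφ' : φ' ∈ Ioo θ (θ + 2 * Real.pi)) :
    (L 1 - L 0).im = (φ' - φ) / 2 := by
  have hslit (t : ℝ) : 1 - δ t / exp (θ * I) ∈ slitPlane := by
    refine one_sub_mem_slitPlane ?_ fun h ↦ hne t ((div_eq_one_iff_eq (exp_ne_zero _)).1 h)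
    rw [norm_div, norm_exp_ofReal_mul_I, div_one]
    exact hle t
  have hlog {t ψ : ℝ} (hδt : δ t = exp (ψ * I)) (hψ : ψ ∈ Ioo θ (θ + 2 * Real.pi)) :
      (log (1 - δ t / exp (θ * I))).im = (ψ - θ - Real.pi) / 2 := by
    rw [hδt, ← exp_sub, ← sub_mul, ← ofReal_sub, log_im,
      arg_one_sub_exp (by linarith [hψ.1]) (by linarith [hψ.2])]
  have hexp' (t : ℝ) : exp (L t) = c * exp (θ * I) * (1 - δ t / exp (θ * I)) := by
    rw [hexp, mul_assoc, mul_one_sub, mul_div_cancel₀ _ (exp_ne_zero _)]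
  rw [sub_eq_log_sub_log_of_exp_eq hL (by fun_prop) hslit hexp' 0 1, sub_im, hlog hδ₁ hφ',
    hlog hδ₀ hφ]
  ring

lemma exists_continuous_exp_eq_sub {γ δ : ℝ → ℂ} (hγ : Continuous γ) (hδ : Continuous δ)
    (hne : ∀ s t, γ s ≠ δ t) :
    ∃ F : ℝ × ℝ → ℂ, Continuous F ∧ ∀ s t, exp (F (s, t)) = γ s - δ t := by
  obtain ⟨F, -, hF⟩ := (isCoveringMapOn_exp.existsUnique_continuousMap_lifts (A := ℝ × ℝ)
    ⟨fun p ↦ γ p.1 - δ p.2, by fun_prop⟩ (a₀ := 0)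
    (exp_log (sub_ne_zero.2 (hne 0 0))) (fun p ↦ sub_ne_zero.2 (hne p.1 p.2))).exists
  exact ⟨F, F.continuous, fun s t ↦ congrFun hF (s, t)⟩

theorem exists_eq_of_interlaced_ends {γ δ : ℝ → ℂ} (hγ : Continuous γ) (hδ : Continuous δ)
    (hγ_le : ∀ t, ‖γ t‖ ≤ 1) (hδ_le : ∀ t, ‖δ t‖ ≤ 1) {α β α' β' : ℝ} (hαβ : α < β) (hβα' : β < α')
    (hα'β' : α' < β') (hβ'α : β' < α + 2 * Real.pi)
    (hγ₀ : γ 0 = exp (α * I)) (hγ₁ : γ 1 = exp (α' * I))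
    (hδ₀ : δ 0 = exp (β * I)) (hδ₁ : δ 1 = exp (β' * I)) : ∃ s t, γ s = δ t := by
  by_contra! hne
  obtain ⟨F, hF, hexp⟩ := exists_continuous_exp_eq_sub hγ hδ hne
  have hturn (ψ : ℝ) : exp (ψ * I) = exp ((ψ + 2 * Real.pi : ℝ) * I) := by
    rw [ofReal_add, add_mul, ofReal_mul, ofReal_ofNat, exp_periodic]
  -- Around the boundary of the unit square, `F` would change by `-2 * π * I` in total.
  have hγ₀_side : (F (0, 1) - F (0, 0)).im = (β' - β) / 2 :=
    im_sub_eq_half_sub_of_exp_eq (L := fun t ↦ F (0, t)) (θ := α) (c := 1) (by fun_prop) hδ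
      (fun t ↦ by rw [hexp, hγ₀, one_mul]) hδ_le (fun t ↦ hγ₀ ▸ (hne 0 t).symm) hδ₀ hδ₁
      ⟨by linarith, by linarith⟩ ⟨by linarith, by linarith⟩
  have hγ₁_side : (F (1, 1) - F (1, 0)).im = (β' - (β + 2 * Real.pi)) / 2 :=
    im_sub_eq_half_sub_of_exp_eq (L := fun t ↦ F (1, t)) (θ := α') (c := 1) (by fun_prop) hδ
      (fun t ↦ by rw [hexp, hγ₁, one_mul]) hδ_le (fun t ↦ hγ₁ ▸ (hne 1 t).symm)
      (hδ₀.trans (hturn β)) hδ₁ ⟨by linarith, by linarith⟩ ⟨by linarith, by linarith⟩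
  have hδ₀_side : (F (1, 0) - F (0, 0)).im = (α' - (α + 2 * Real.pi)) / 2 :=
    im_sub_eq_half_sub_of_exp_eq (L := fun s ↦ F (s, 0)) (θ := β) (c := -1) (by fun_prop) hγ
      (fun s ↦ by rw [hexp, hδ₀]; ring) hγ_le (fun s ↦ hδ₀ ▸ hne s 0)
      (hγ₀.trans (hturn α)) hγ₁ ⟨by linarith, by linarith⟩ ⟨by linarith, by linarith⟩
  have hδ₁_side : (F (1, 1) - F (0, 1)).im = (α' + 2 * Real.pi - (α + 2 * Real.pi)) / 2 :=
    im_sub_eq_half_sub_of_exp_eq (L := fun s ↦ F (s, 1)) (θ := β') (c := -1) (by fun_prop) hγ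
      (fun s ↦ by rw [hexp, hδ₁]; ring) hγ_le (fun s ↦ hδ₁ ▸ hne s 1)
      (hγ₀.trans (hturn α)) (hγ₁.trans (hturn α')) ⟨by linarith, by linarith⟩
      ⟨by linarith, by linarith⟩
  simp only [sub_im] at hγ₀_side hγ₁_side hδ₀_side hδ₁_side
  linarith [Real.pi_pos]

end ChordsOfTheDisc

section Interlacing

variable {V : Type*} [LinearOrder V] {a b c d e x x' y y' v : V}

/-- The pairs `a, b` and `c, d` separate each other on the circle that arises by closing up the
line `V`. Both pairs are unordered, and the four points are then distinct. -/
def Interlaced (a b c d : V) : Prop :=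
  c ∈ uIoo a b ∧ d ∉ uIcc a b ∨ d ∈ uIoo a b ∧ c ∉ uIcc a b

lemma Interlaced.swap (h : Interlaced a b c d) : Interlaced a b d c :=
  Or.symm h

lemma Interlaced.symm (h : Interlaced a b c d) : Interlaced c d a b := by
  grind [Interlaced, uIoo, uIcc]

lemma not_interlaced_self (a b c : V) : ¬Interlaced a b c c := by
  grind [Interlaced, uIoo, uIcc]

lemma Interlaced.cotrans (h : Interlaced a b c d) (hea : e ≠ a) (heb : e ≠ b) :
    Interlaced a b c e ∨ Interlaced a b e d := by
  grind [Interlaced, uIoo, uIcc]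

lemma interlaced_trichotomy (hab : a ≠ b) (hac : a ≠ c) (had : a ≠ d) (hbc : b ≠ c) (hbd : b ≠ d)
    (hcd : c ≠ d) : Interlaced a b c d ∨ Interlaced a c b d ∨ Interlaced a d b c := by
  grind (splits := 20) [Interlaced, uIoo, uIcc]

lemma exists_interlaced_of_pairwise_disjoint {X : Fin 3 → Set V} (hX : ∀ i, (X i).Nonempty)
    (hXX : Pairwise (Disjoint on X)) (ha : ∀ i, a ∉ X i) :
    ∃ i j l, j ≠ i ∧ l ≠ i ∧ ∃ x ∈ X i, ∃ y ∈ X j, ∃ z ∈ X l, Interlaced y z x a := by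
  choose x hx using hX
  have hne (i j : Fin 3) (hij : i ≠ j) : x i ≠ x j := (hXX hij).ne_of_mem (hx i) (hx j)
  have hne' (i : Fin 3) : x i ≠ a := ne_of_mem_of_not_mem (hx i) (ha i)
  rcases interlaced_trichotomy (hne 0 1 (by decide)) (hne 0 2 (by decide)) (hne' 0)
    (hne 1 2 (by decide)) (hne' 1) (hne' 2) with h | h | h
  · exact ⟨2, 0, 1, by decide, by decide, _, hx 2, _, hx 0, _, hx 1, h⟩
  · exact ⟨1, 0, 2, by decide, by decide, _, hx 1, _, hx 0, _, hx 2, h⟩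
  · exact ⟨0, 1, 2, by decide, by decide, _, hx 0, _, hx 1, _, hx 2, h.symm⟩

lemma exists_perm_interlaced {x : Fin 4 → V} (hx : Function.Injective x) :
    ∃ σ : Equiv.Perm (Fin 4), Interlaced (x (σ 0)) (x (σ 1)) (x (σ 2)) (x (σ 3)) := by
  have hne (i j : Fin 4) (hij : i ≠ j) : x i ≠ x j := hx.ne hij
  rcases interlaced_trichotomy (hne 0 1 (by decide)) (hne 0 2 (by decide)) (hne 0 3 (by decide))
    (hne 1 2 (by decide)) (hne 1 3 (by decide)) (hne 2 3 (by decide)) with h | h | h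
  · exact ⟨1, h⟩
  · exact ⟨.swap 1 2, h⟩
  · exact ⟨.swap 1 3, h.swap⟩

lemma Interlaced.of_common_end (h : Interlaced x x' y v) (h' : Interlaced y y' x v) :
    Interlaced x x' y y' := by
  grind [Interlaced, uIoo, uIcc]

lemma Interlaced.not_rel {r : V → V → Prop} (hr : ∀ x y, r x y → r y x)
    (hcross : ∀ ⦃a b c d⦄, a < b → b < c → c < d → r a c → ¬r b d) (h : Interlaced a b c d) :
    r a b → ¬r c d := by
  grind [Interlaced, uIoo, uIcc]

end Interlacing

section NonCrossing

variable {V : Type*} {G : SimpleGraph V}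

/-- If the vertices are placed on a line, in their order, and the edges are drawn as half circles on
one side of that line, then no two edges cross. -/
def NonCrossing [LinearOrder V] (G : SimpleGraph V) : Prop :=
  ∀ ⦃a b c d⦄, Interlaced a b c d → G.Adj a b → ¬G.Adj c d

section OuterplanarDrawing

open Complex

lemma OuterplanarDrawing.pos_eq_exp_arg (D : OuterplanarDrawing G) (v : V) :
    D.pos v = exp (arg (D.pos v) * I) := by
  simpa [mem_sphere_zero_iff_norm.1 (D.pos_mem v)] using (norm_mul_exp_arg_mul_I (D.pos v)).symm

lemma OuterplanarDrawing.injective_arg_pos (D : OuterplanarDrawing G) :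
    Function.Injective fun v ↦ arg (D.pos v) := fun v w h ↦
  D.pos_injective <| by
    rw [D.pos_eq_exp_arg v, D.pos_eq_exp_arg w]
    exact congrArg (fun θ : ℝ ↦ exp (θ * I)) h

lemma OuterplanarDrawing.exists_curve (D : OuterplanarDrawing G) {u v : V} (h : G.Adj u v) :
    ∃ γ : ℝ → ℂ, Continuous γ ∧ (∀ t, γ t ∈ D.arc s(u, v)) ∧ (∀ t, ‖γ t‖ ≤ 1) ∧
      γ 0 = D.pos u ∧ γ 1 = D.pos v := by
  obtain ⟨γ, -, hγ⟩ := D.exists_path u v h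
  have hmem (t : ℝ) : γ.extend t ∈ D.arc s(u, v) := hγ ▸ γ.extend_range ▸ mem_range_self t
  exact ⟨γ.extend, γ.continuous_extend, hmem,
    fun t ↦ mem_closedBall_zero_iff.1 (D.arc_subset _ h (hmem t)), γ.extend_zero, γ.extend_one⟩

lemma OuterplanarDrawing.not_adj_of_arg_lt (D : OuterplanarDrawing G) {a b c d : V}
    (hab : arg (D.pos a) < arg (D.pos b)) (hbc : arg (D.pos b) < arg (D.pos c))
    (hcd : arg (D.pos c) < arg (D.pos d)) (hac : G.Adj a c) : ¬G.Adj b d := fun hbd ↦ by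
  obtain ⟨γ, hγ, hγ_mem, hγ_le, hγ₀, hγ₁⟩ := D.exists_curve hac
  obtain ⟨δ, hδ, hδ_mem, hδ_le, hδ₀, hδ₁⟩ := D.exists_curve hbd
  obtain ⟨s, t, hst⟩ := exists_eq_of_interlaced_ends hγ hδ hγ_le hδ_le hab hbc hcd
    (by linarith [arg_le_pi (D.pos d), neg_pi_lt_arg (D.pos a)])
    (hγ₀.trans (D.pos_eq_exp_arg a)) (hγ₁.trans (D.pos_eq_exp_arg c))
    (hδ₀.trans (D.pos_eq_exp_arg b)) (hδ₁.trans (D.pos_eq_exp_arg d))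
  have hno_common_end (w : V) (hw : w ∈ s(a, c)) : w ∉ s(b, d) := by
    rw [Sym2.mem_iff] at hw ⊢
    rintro (rfl | rfl) <;> rcases hw with rfl | rfl <;> linarith
  have hne : s(a, c) ≠ s(b, d) := fun h ↦
    hno_common_end a (Sym2.mem_mk_left a c) (h ▸ Sym2.mem_mk_left a c)
  obtain ⟨w, hw, hw', -⟩ := D.inter_subset _ hac _ hbd hne (γ s) ⟨hγ_mem s, hst ▸ hδ_mem t⟩
  exact hno_common_end w hw hw'

theorem IsOuterplanar.exists_nonCrossing (h : IsOuterplanar G) :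
    ∃ _ : LinearOrder V, NonCrossing G := by
  obtain ⟨D⟩ := h
  let _ : LinearOrder V := LinearOrder.lift' (fun v ↦ arg (D.pos v)) D.injective_arg_pos
  exact ⟨_, fun a b c d h ↦ h.not_rel (fun _ _ ↦ SimpleGraph.Adj.symm)
    fun _ _ _ _ hab hbc hcd ↦ D.not_adj_of_arg_lt hab hbc hcd⟩

end OuterplanarDrawing

lemma exists_boundary_adj {S : Set V} (hS : (G.induce S).Connected) {P : V → Prop} {s s' : V}
    (hs : s ∈ S) (hs' : s' ∈ S) (h : P s) (h' : ¬P s') :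
    ∃ u ∈ S, ∃ w ∈ S, G.Adj u w ∧ P u ∧ ¬P w := by
  obtain ⟨p⟩ := hS ⟨s, hs⟩ ⟨s', hs'⟩
  obtain ⟨e, -, h₁, h₂⟩ := p.exists_boundary_dart {v | P v.1} h h'
  exact ⟨e.fst, e.fst.2, e.snd, e.snd.2, e.adj, h₁, h₂⟩

variable [LinearOrder V] {S T : Set V} {a b c d : V}

lemma Interlaced.exists_adj (h : Interlaced a b c d) (hS : (G.induce S).Connected)
    (hc : c ∈ S) (hd : d ∈ S) (ha : a ∉ S) (hb : b ∉ S) :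
    ∃ u ∈ S, ∃ w ∈ S, G.Adj u w ∧ Interlaced a b u w := by
  obtain ⟨u, hu, w, hw, huw, hcu, hcw⟩ := exists_boundary_adj hS
    (P := fun v ↦ ¬Interlaced a b c v) hc hd (not_interlaced_self a b c) (not_not.2 h)
  have hau : u ≠ a := fun e ↦ ha (e ▸ hu)
  have hbu : u ≠ b := fun e ↦ hb (e ▸ hu)
  exact ⟨u, hu, w, hw, huw, ((not_not.1 hcw).cotrans hau hbu).resolve_left hcu⟩

theorem NonCrossing.not_interlaced (hG : NonCrossing G) (hS : (G.induce S).Connected)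
    (hT : (G.induce T).Connected) (hST : Disjoint S T) (ha : a ∈ S) (hb : b ∈ S) (hc : c ∈ T)
    (hd : d ∈ T) : ¬Interlaced a b c d := fun h ↦ by
  obtain ⟨u, hu, w, hw, huw, h'⟩ := h.exists_adj hT hc hd
    (hST.notMem_of_mem_left ha) (hST.notMem_of_mem_left hb)
  obtain ⟨u', -, w', -, huw', h''⟩ := h'.symm.exists_adj hS ha hb
    (hST.notMem_of_mem_right hu) (hST.notMem_of_mem_right hw)
  exact hG h'' huw huw'

/-- `v` and `w` lie outside `S`, and on the same side of every chord of the circle that joins two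
points of `S`. -/
def SameSide (S : Set V) (v w : V) : Prop :=
  v ∉ S ∧ w ∉ S ∧ ∀ x ∈ S, ∀ x' ∈ S, ¬Interlaced x x' v w

lemma SameSide.symm (h : SameSide S a b) : SameSide S b a :=
  ⟨h.2.1, h.1, fun x hx x' hx' h' ↦ h.2.2 x hx x' hx' h'.swap⟩

lemma SameSide.trans (h : SameSide S a b) (h' : SameSide S b c) : SameSide S a c :=
  ⟨h.1, h'.2.1, fun x hx x' hx' hac ↦
    (hac.cotrans (ne_of_mem_of_not_mem hx h.2.1).symm (ne_of_mem_of_not_mem hx' h.2.1).symm).elim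
      (h.2.2 x hx x' hx') (h'.2.2 x hx x' hx')⟩

lemma SameSide.anti (h : SameSide T a b) (hST : S ⊆ T) : SameSide S a b :=
  ⟨fun ha ↦ h.1 (hST ha), fun hb ↦ h.2.1 (hST hb),
    fun x hx x' hx' ↦ h.2.2 x (hST hx) x' (hST hx')⟩

lemma exists_interlaced_of_not_sameSide (h : ¬SameSide S a b) (ha : a ∉ S) (hb : b ∉ S) :
    ∃ x ∈ S, ∃ x' ∈ S, Interlaced x x' a b := by
  by_contra! h'
  exact h ⟨ha, hb, h'⟩

lemma NonCrossing.sameSide (hG : NonCrossing G) (hS : (G.induce S).Connected)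
    (hT : (G.induce T).Connected) (hST : Disjoint S T) (ha : a ∈ T) (hb : b ∈ T) :
    SameSide S a b :=
  ⟨hST.notMem_of_mem_right ha, hST.notMem_of_mem_right hb,
    fun _ hx _ hx' ↦ hG.not_interlaced hS hT hST hx hx' ha hb⟩

lemma NonCrossing.sameSide_of_walk (hG : NonCrossing G) (hS : (G.induce S).Connected)
    (p : G.Walk a b) (hp : ∀ v ∈ p.support, v ∉ S) : SameSide S a b :=
  hG.sameSide hS p.connected_induce_support
    (disjoint_left.2 fun v hv hvp ↦ hp v hvp hv) p.start_mem_support p.end_mem_support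

theorem NonCrossing.sameSide_or_sameSide (hG : NonCrossing G) (hS : (G.induce S).Connected)
    (hT : (G.induce T).Connected) (hST : Disjoint S T) {s t : V} (hs : s ∈ S) (ht : t ∈ T) (v : V) :
    SameSide S t v ∨ SameSide T s v := by
  by_cases hvS : v ∈ S
  · exact Or.inr (hG.sameSide hT hS hST.symm hs hvS)
  by_cases hvT : v ∈ T
  · exact Or.inl (hG.sameSide hS hT hST ht hvT)
  by_contra! ⟨hS_sep, hT_sep⟩
  obtain ⟨x, hx, x', hx', hxtv⟩ :=
    exists_interlaced_of_not_sameSide hS_sep (hST.notMem_of_mem_right ht) hvS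
  obtain ⟨y, hy, y', hy', hyxv⟩ := exists_interlaced_of_not_sameSide
    (fun h ↦ hT_sep ((hG.sameSide hT hS hST.symm hs hx).trans h)) (hST.notMem_of_mem_left hx) hvT
  have hxyv : Interlaced x x' y v :=
    (hxtv.cotrans (ne_of_mem_of_not_mem hy (hST.notMem_of_mem_left hx))
      (ne_of_mem_of_not_mem hy (hST.notMem_of_mem_left hx'))).resolve_left
      (hG.not_interlaced hS hT hST hx hx' ht hy)
  exact hG.not_interlaced hS hT hST hx hx' hy hy' (hxyv.of_common_end hyxv)

end NonCrossing

section Distance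

open SimpleGraph

variable {V : Type*} {G : SimpleGraph V} {a b v : V} {m n : ℕ} {P Q : V → Prop}

/-- Every vertex with the property `P` has distance at least `n` from `a`, possibly infinite. -/
def FarFrom (G : SimpleGraph V) (n : ℕ) (a : V) (P : V → Prop) : Prop :=
  ∀ ⦃w⦄, P w → ∀ p : G.Walk a w, n ≤ p.length

lemma FarFrom.not_self (h : FarFrom G (n + 1) a P) : ¬P a := fun ha ↦
  Nat.not_succ_le_zero n (h ha .nil)

lemma FarFrom.add_le_length (ha : FarFrom G m a P) (hb : FarFrom G n b Q) (p : G.Walk a b)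
    (hv : v ∈ p.support) (hP : P v) (hQ : Q v) : m + n ≤ p.length := by
  obtain ⟨q, r, rfl⟩ := Walk.mem_support_iff_exists_append.1 hv
  rw [Walk.length_append, ← r.length_reverse]
  exact add_le_add (ha hP q) (hb hQ r.reverse)

lemma FarFrom.add_lt_length_of_cover (ha : FarFrom G (m + 1) a P) (hb : FarFrom G (n + 1) b Q)
    (hPQ : ∀ v, P v ∨ Q v) (p : G.Walk a b) : m + n < p.length := by
  rcases hPQ (p.getVert m) with hP | hQ
  · have := ha hP (p.take m)
    grind [Walk.take_length]
  · have := hb hQ (p.drop m).reverse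
    grind [Walk.drop_length, Walk.length_reverse]

lemma exists_walk_length_lt_of_ediam_lt (h : G.ediam < n) (a b : V) :
    ∃ p : G.Walk a b, p.length < n := by
  have hlt : G.edist a b < n := edist_le_ediam.trans_lt h
  obtain ⟨p, hp⟩ := exists_walk_of_edist_ne_top hlt.ne_top
  exact ⟨p, by exact_mod_cast hp.trans_lt hlt⟩

end Distance

section TernaryTrees

open SimpleGraph

variable {V : Type*} {G : SimpleGraph V} {X Y Z : Set V} {k : ℕ}

/-- `X` is partitioned into connected sets, one for each node of the complete ternary tree of height
`k`, and `G` has an edge between the sets of any node and of each of its children. -/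
inductive CarriesTernaryTree (G : SimpleGraph V) : ℕ → Set V → Prop
  | zero {X : Set V} (hX : (G.induce X).Connected) : CarriesTernaryTree G 0 X
  | succ {k : ℕ} {X : Set V} {Y : Fin 3 → Set V} (hX : (G.induce X).Connected)
      (hY : ∀ i, CarriesTernaryTree G k (Y i)) (hXY : ∀ i, Disjoint X (Y i))
      (hYY : Pairwise (Disjoint on Y))
      (hadj : ∀ i, ∃ x ∈ X, ∃ y ∈ Y i, G.Adj x y) : CarriesTernaryTree G (k + 1) (X ∪ ⋃ i, Y i)

lemma connected_induce_union_iUnion {ι : Type*} {Y : ι → Set V} (hX : (G.induce X).Connected)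
    (hY : ∀ i, (G.induce (Y i)).Connected) (hadj : ∀ i, ∃ x ∈ X, ∃ y ∈ Y i, G.Adj x y) :
    (G.induce (X ∪ ⋃ i, Y i)).Connected := by
  obtain ⟨x₀, hx₀⟩ := hX.nonempty
  refine G.induce_connected_of_patches x₀ (Or.inl hx₀) fun {v} hv ↦ ?_
  rcases hv with hv | hv
  · exact ⟨X, subset_union_left, hx₀, hv, hX _ _⟩
  · obtain ⟨i, hvi⟩ := mem_iUnion.1 hv
    obtain ⟨x, hx, y, hy, hxy⟩ := hadj i
    exact ⟨X ∪ Y i, union_subset_union_right X (subset_iUnion Y i), Or.inl hx₀, Or.inr hvi,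
      connected_induce_union hX.preconnected (hY i).preconnected hx hy hxy _ _⟩

lemma CarriesTernaryTree.connected (h : CarriesTernaryTree G k X) : (G.induce X).Connected := by
  induction h with
  | zero hX => exact hX
  | succ hX _ _ _ hadj ih => exact connected_induce_union_iUnion hX ih hadj

lemma CarriesTernaryTree.nonempty (h : CarriesTernaryTree G k X) : X.Nonempty :=
  nonempty_subtype.1 h.connected.nonempty

variable [LinearOrder V]

/-- Among four points on a circle, some child `Y i` and `o` lie on different sides of the set `S`
that consists of the root and the other two children. A walk from a vertex deep behind `Y i` can
therefore reach the side of `o` only through `S`, and it takes at least one further step to leave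
the tree. -/
theorem CarriesTernaryTree.exists_farFrom (hG : NonCrossing G) (h : CarriesTernaryTree G k X)
    (o : V) : ∃ a, FarFrom G (k + 1) a (SameSide X o) := by
  induction h generalizing o with
  | @zero X hX =>
    obtain ⟨x, hx⟩ := hX.nonempty
    refine ⟨x, fun w hw p ↦ Nat.one_le_iff_ne_zero.2 fun hp ↦ ?_⟩
    exact hw.2.1 (Walk.eq_of_length_eq_zero hp ▸ hx)
  | @succ k X₀ Y hX₀ hY hXY hYY hadj ih =>
    by_cases ho : o ∈ X₀ ∪ ⋃ i, Y i
    · exact ⟨o, fun w hw ↦ absurd ho hw.1⟩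
    obtain ⟨s, hs⟩ := hX₀.nonempty
    obtain ⟨i, j, l, hji, hli, y, hy, y', hy', y'', hy'', hsep⟩ :=
      exists_interlaced_of_pairwise_disjoint (fun i ↦ (hY i).nonempty) hYY
        fun i hoi ↦ ho (Or.inr (mem_iUnion_of_mem i hoi))
    let S := X₀ ∪ ⋃ j : {j // j ≠ i}, Y j
    have hS : (G.induce S).Connected := connected_induce_union_iUnion hX₀
      (fun j : {j // j ≠ i} ↦ (hY j).connected) fun j ↦ hadj j
    have hS_sub : S ⊆ X₀ ∪ ⋃ i, Y i :=
      union_subset_union_right X₀ (iUnion_subset fun j ↦ subset_iUnion Y j)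
    have hYS : Disjoint (Y i) S := disjoint_union_right.2
      ⟨(hXY i).symm, disjoint_iUnion_right.2 fun j ↦ hYY j.2.symm⟩
    have hS_sep : ¬SameSide S y o := fun h ↦ h.2.2 _ (Or.inr (mem_iUnion.2 ⟨⟨j, hji⟩, hy'⟩))
      _ (Or.inr (mem_iUnion.2 ⟨⟨l, hli⟩, hy''⟩)) hsep
    obtain ⟨a, ha⟩ := ih i s
    have ha_side : SameSide S y a := (hG.sameSide_or_sameSide hS (hY i).connected hYS.symm
      (Or.inl hs) hy a).resolve_right ha.not_self
    refine ⟨a, fun w hw p ↦ ?_⟩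
    by_cases hp : ∀ v ∈ p.support, v ∉ S
    · have hw_side : SameSide S w o := hw.symm.anti hS_sub
      exact absurd ((ha_side.trans (hG.sameSide_of_walk hS p hp)).trans hw_side) hS_sep
    push Not at hp
    obtain ⟨v, hvp, hvS⟩ := hp
    have hvw : v ≠ w := ne_of_mem_of_not_mem (hS_sub hvS) hw.2.1
    calc k + 1 < (p.takeUntil v hvp).length + 1 :=
          Nat.lt_succ_of_le (ha (hG.sameSide (hY i).connected hS hYS (Or.inl hs) hvS) _)
      _ ≤ p.length := Walk.length_takeUntil_lt_length hvp hvw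

theorem NonCrossing.le_ediam_of_disjoint (hG : NonCrossing G) (hX : CarriesTernaryTree G k X)
    (hY : CarriesTernaryTree G k Y) (hXY : Disjoint X Y) : ((2 * k + 1 : ℕ) : ℕ∞) ≤ G.ediam := by
  by_contra! hlt
  obtain ⟨x, hx⟩ := hX.nonempty
  obtain ⟨y, hy⟩ := hY.nonempty
  obtain ⟨a, ha⟩ := hX.exists_farFrom hG y
  obtain ⟨b, hb⟩ := hY.exists_farFrom hG x
  obtain ⟨p, hp⟩ := exists_walk_length_lt_of_ediam_lt hlt a b
  have := ha.add_lt_length_of_cover hb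
    (hG.sameSide_or_sameSide hX.connected hY.connected hXY hx hy) p
  lia

theorem NonCrossing.le_ediam_of_not_sameSide (hG : NonCrossing G) (hX : CarriesTernaryTree G k X)
    (hY : CarriesTernaryTree G k Y) (hZ : (G.induce Z).Connected) (hXZ : Disjoint X Z)
    (hYZ : Disjoint Y Z) {x y : V} (hx : x ∈ X) (hy : y ∈ Y) (hxy : ¬SameSide Z x y) :
    ((2 * k + 2 : ℕ) : ℕ∞) ≤ G.ediam := by
  by_contra! hlt
  obtain ⟨z, hz⟩ := hZ.nonempty
  obtain ⟨a, ha⟩ := hX.exists_farFrom hG z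
  obtain ⟨b, hb⟩ := hY.exists_farFrom hG z
  have hxa : SameSide Z x a :=
    (hG.sameSide_or_sameSide hZ hX.connected hXZ.symm hz hx a).resolve_right ha.not_self
  have hyb : SameSide Z y b :=
    (hG.sameSide_or_sameSide hZ hY.connected hYZ.symm hz hy b).resolve_right hb.not_self
  obtain ⟨p, hp⟩ := exists_walk_length_lt_of_ediam_lt hlt a b
  have hpZ : ∃ v ∈ p.support, v ∈ Z := by
    by_contra! hpZ
    exact hxy ((hxa.trans (hG.sameSide_of_walk hZ p hpZ)).trans hyb.symm)
  obtain ⟨v, hvp, hvZ⟩ := hpZ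
  have := ha.add_le_length hb p hvp (hG.sameSide hX.connected hZ hXZ hz hvZ)
    (hG.sameSide hY.connected hZ hYZ hz hvZ)
  lia

theorem NonCrossing.le_ediam_of_carries_succ (hG : NonCrossing G)
    (hX : CarriesTernaryTree G (k + 1) X) : ((2 * k + 2 : ℕ) : ℕ∞) ≤ G.ediam := by
  cases hX with
  | @succ _ X₀ Y hX₀ hY hXY hYY hadj =>
    obtain ⟨s, hs⟩ := hX₀.nonempty
    obtain ⟨i, j, l, hji, hli, y, hy, y', hy', y'', hy'', hsep⟩ :=
      exists_interlaced_of_pairwise_disjoint (fun i ↦ (hY i).nonempty) hYY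
        fun i ↦ (hXY i).notMem_of_mem_left hs
    obtain ⟨x, hx, z, hz, hxz⟩ := hadj i
    have hZ : (G.induce (X₀ ∪ Y i)).Connected :=
      connected_induce_union hX₀.preconnected (hY i).connected.preconnected hx hz hxz
    have hYZ {j : Fin 3} (hji : j ≠ i) : Disjoint (Y j) (X₀ ∪ Y i) :=
      disjoint_union_right.2 ⟨(hXY j).symm, hYY hji⟩
    exact hG.le_ediam_of_not_sameSide (hY j) (hY l) hZ (hYZ hji) (hYZ hli) hy' hy''
      fun h ↦ h.2.2 _ (Or.inr hy) _ (Or.inl hs) hsep.symm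

lemma NonCrossing.le_ediam_of_four_farFrom (hG : NonCrossing G) {a : Fin 4 → V}
    {P : Fin 4 → V → Prop} (ha : ∀ i, FarFrom G (k + 1) (a i) (P i))
    (hP : ∀ i j, i ≠ j → ∀ v, P i v ∨ P j v) : ((2 * k + 2 : ℕ) : ℕ∞) ≤ G.ediam := by
  have ha_inj : Function.Injective a := fun i j haij ↦ by_contra fun hij ↦
    (hP i j hij (a i)).elim (ha i).not_self (haij ▸ (ha j).not_self)
  obtain ⟨σ, hσ⟩ := exists_perm_interlaced ha_inj
  by_contra! hlt
  obtain ⟨p, hp⟩ := exists_walk_length_lt_of_ediam_lt hlt (a (σ 0)) (a (σ 1))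
  obtain ⟨q, hq⟩ := exists_walk_length_lt_of_ediam_lt hlt (a (σ 2)) (a (σ 3))
  have hpq : ∃ v ∈ p.support, v ∈ q.support := by
    by_contra! hpq
    exact hG.not_interlaced p.connected_induce_support q.connected_induce_support
      (disjoint_left.2 hpq) p.start_mem_support p.end_mem_support q.start_mem_support
      q.end_mem_support hσ
  obtain ⟨v, hvp, hvq⟩ := hpq
  have hvP {i j : Fin 4} (hij : i ≠ j) (h : ¬P (σ i) v) : P (σ j) v :=
    (hP _ _ (σ.injective.ne hij) v).resolve_left h
  have hp_fails : ¬P (σ 0) v ∨ ¬P (σ 1) v := by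
    by_contra! ⟨h₀, h₁⟩
    have := (ha (σ 0)).add_le_length (ha (σ 1)) p hvp h₀ h₁
    lia
  have hq_fails : ¬(P (σ 2) v ∧ P (σ 3) v) := fun ⟨h₂, h₃⟩ ↦ by
    have := (ha (σ 2)).add_le_length (ha (σ 3)) q hvq h₂ h₃
    lia
  rcases hp_fails with h | h <;> exact hq_fails ⟨hvP (by decide) h, hvP (by decide) h⟩

theorem NonCrossing.le_ediam_of_pairwise_disjoint (hG : NonCrossing G) {X : Fin 4 → Set V}
    (hX : ∀ i, CarriesTernaryTree G k (X i)) (hXX : Pairwise (Disjoint on X)) :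
    ((2 * k + 2 : ℕ) : ℕ∞) ≤ G.ediam := by
  choose x hx using fun i ↦ (hX i).nonempty
  by_cases hside : ∀ i j l, j ≠ i → l ≠ i → SameSide (X i) (x j) (x l)
  · choose a ha using fun i ↦ (hX i).exists_farFrom hG (x (i + 1))
    have hsucc (i : Fin 4) : i + 1 ≠ i := by simp
    exact hG.le_ediam_of_four_farFrom ha fun i j hij v ↦
      (hG.sameSide_or_sameSide (hX i).connected (hX j).connected (hXX hij) (hx i) (hx j) v).imp
        (hside i _ _ (hsucc i) hij.symm).trans (hside j _ _ (hsucc j) hij).trans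
  · push Not at hside
    obtain ⟨i, j, l, hji, hli, hsep⟩ := hside
    exact hG.le_ediam_of_not_sameSide (hX j) (hX l) (hX i).connected (hXX hji) (hXX hli) (hx j)
      (hx l) hsep

end TernaryTrees

section MinorModels

variable {V W : Type*} {G : SimpleGraph V} {H : SimpleGraph W} {k : ℕ}

/-- The branch sets `β` witness that `H` is a minor of `G`. -/
structure IsMinorModel (H : SimpleGraph W) (G : SimpleGraph V) (β : W → Set V) : Prop where
  connected w : (G.induce (β w)).Connected
  disjoint : Pairwise (Disjoint on β)
  exists_adj ⦃w w'⦄ (h : H.Adj w w') : ∃ x ∈ β w, ∃ y ∈ β w', G.Adj x y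

lemma IsMinor.exists_isMinorModel (h : IsMinor H G) : ∃ β, IsMinorModel H G β :=
  let ⟨β, hconn, hdisj, hadj⟩ := h
  ⟨β, hconn, hdisj, hadj⟩

lemma isMinor_refl (G : SimpleGraph V) : IsMinor G G :=
  ⟨fun v ↦ {v}, fun _ ↦ { preconnected := .of_subsingleton, nonempty := inferInstance },
    fun _ _ ↦ disjoint_singleton.2, fun v w h ↦ ⟨v, rfl, w, rfl, h⟩⟩

lemma IsMinor.mono {G' : SimpleGraph V} (h : IsMinor H G) (hG : G ≤ G') : IsMinor H G' := by
  obtain ⟨β, hconn, hdisj, hadj⟩ := h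
  refine ⟨β, fun w ↦ (hconn w).mono fun x y hxy ↦ hG hxy, hdisj, fun w w' hw ↦ ?_⟩
  obtain ⟨x, hx, y, hy, hxy⟩ := hadj w w' hw
  exact ⟨x, hx, y, hy, hG hxy⟩

namespace IsMinorModel

lemma comp {W' : Type*} {H' : SimpleGraph W'} {β : W → Set V} (h : IsMinorModel H G β)
    {φ : H' →g H} (hφ : Function.Injective φ) : IsMinorModel H' G (β ∘ φ) where
  connected _ := h.connected _
  disjoint := h.disjoint.comp_of_injective hφ
  exists_adj _ _ hab := h.exists_adj (φ.map_adj hab)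

variable {i : ℕ} {F : Fin i → Gr}

lemma summand {β : (disjointUnion F).V → Set V} (h : IsMinorModel (disjointUnion F).graph G β)
    (j : Fin i) : IsMinorModel (F j).graph G fun v ↦ β ⟨j, v⟩ :=
  h.comp (φ := ⟨fun v ↦ ⟨j, v⟩, fun hab ↦ ⟨j, _, _, rfl, rfl, hab⟩⟩)
    (sigma_mk_injective (β := fun j ↦ (F j).V))

lemma pairwise_disjoint_summands {β : (disjointUnion F).V → Set V}
    (h : IsMinorModel (disjointUnion F).graph G β) :
    Pairwise (Disjoint on fun j ↦ ⋃ v, β ⟨j, v⟩) := fun j j' hj ↦ by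
  simp only [Function.onFun, disjoint_iUnion_left, disjoint_iUnion_right]
  exact fun _ _ ↦ h.disjoint fun e ↦ hj (congrArg Sigma.fst e)

lemma disjointUnion_of_joinVertex {a : ∀ j, (F j).V} {β : (joinVertex F a).V → Set V}
    (h : IsMinorModel (joinVertex F a).graph G β) :
    IsMinorModel (disjointUnion F).graph G fun v ↦ β (some v) :=
  h.comp (φ := ⟨some, fun hpq ↦ Or.inl ⟨_, _, rfl, rfl, hpq⟩⟩) (Option.some_injective _)

lemma carriesTernaryTree_K13 {β : K13.V → Set V} (h : IsMinorModel K13.graph G β) :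
    CarriesTernaryTree G 1 (⋃ v, β v) := by
  have hβ : ⋃ v, β v = β (.inl 0) ∪ ⋃ j, β (.inr j) :=
    (iUnion_sum (s := β)).trans (congrArg (· ∪ _) (iSup_unique (f := fun j : Fin 1 ↦ β (.inl j))))
  rw [hβ]
  exact .succ (h.connected _) (fun _ ↦ .zero (h.connected _)) (fun _ ↦ h.disjoint Sum.inl_ne_inr)
    (h.disjoint.comp_of_injective Sum.inr_injective)
    fun _ ↦ h.exists_adj (Or.inl ⟨rfl, rfl⟩)

lemma carriesTernaryTree_joinVertex {F : Fin 3 → Gr} {a : ∀ j, (F j).V}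
    {β : (joinVertex F a).V → Set V} (h : IsMinorModel (joinVertex F a).graph G β)
    (hF : ∀ j, CarriesTernaryTree G k (⋃ v, β (some ⟨j, v⟩))) :
    CarriesTernaryTree G (k + 1) (⋃ v, β v) := by
  have hβ : ⋃ v, β v = β none ∪ ⋃ j, ⋃ v, β (some ⟨j, v⟩) :=
    (iUnion_option β).trans (congrArg (_ ∪ ·) (iUnion_sigma fun v ↦ β (some v)))
  rw [hβ]
  refine .succ (h.connected _) hF
    (fun j ↦ disjoint_iUnion_right.2 fun v ↦ h.disjoint (Option.some_ne_none _).symm)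
    h.disjointUnion_of_joinVertex.pairwise_disjoint_summands fun j ↦ ?_
  obtain ⟨x, hx, y, hy, hxy⟩ := h.exists_adj (Or.inr (Or.inl ⟨j, rfl, rfl⟩))
  exact ⟨x, hx, y, mem_iUnion_of_mem (a j) hy, hxy⟩

end IsMinorModel

end MinorModels

section Families

variable {V : Type*} {G : SimpleGraph V} {H : Gr} {β : H.V → Set V} {k : ℕ}

lemma famB_two_mul (k : ℕ) : famB (2 * k) = ∅ := by
  cases k with
  | zero => rfl
  | succ k => rw [mul_add_one, famB, if_pos (by lia)]

lemma famB_two_mul_add_three (k : ℕ) : famB (2 * k + 3) = joinCopies 3 (famB (2 * k + 1)) := by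
  rw [famB, if_neg (by lia)]

lemma famA_two_mul_add_one (k : ℕ) : famA (2 * k + 1) = copies 2 (famA (2 * k)) := by
  rw [famA, if_neg (by lia)]

lemma famA_two_mul_add_two (k : ℕ) : famA (2 * k + 2) = copies 2 (famB (2 * k + 1)) := by
  rw [famA, if_pos (by lia)]

lemma carriesTernaryTree_of_mem_famB (hH : H ∈ famB (2 * k + 1)) (h : IsMinorModel H.graph G β) :
    CarriesTernaryTree G (k + 1) (⋃ v, β v) := by
  induction k generalizing H with
  | zero =>
    obtain rfl : H = K13 := hH
    exact h.carriesTernaryTree_K13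
  | succ k ih =>
    rw [mul_add_one, famB_two_mul_add_three] at hH
    obtain ⟨F, a, hF, rfl⟩ := hH
    exact h.carriesTernaryTree_joinVertex fun j ↦
      ih (hF j) (h.disjointUnion_of_joinVertex.summand j)

lemma exists_two_carriesTernaryTree_of_mem_famA (hH : H ∈ famA (2 * k))
    (h : IsMinorModel H.graph G β) : ∃ X : Fin 2 → Set V, (∀ i, CarriesTernaryTree G k (X i)) ∧
      Pairwise (Disjoint on X) ∧ ∀ i, X i ⊆ ⋃ v, β v := by
  cases k with
  | zero =>
    obtain rfl : H = twoK1 := hH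
    exact ⟨β, fun i ↦ .zero (h.connected i), h.disjoint, subset_iUnion β⟩
  | succ k =>
    rw [mul_add_one, famA_two_mul_add_two] at hH
    obtain ⟨F, hF, rfl⟩ := hH
    exact ⟨fun j ↦ ⋃ v, β ⟨j, v⟩, fun j ↦ carriesTernaryTree_of_mem_famB (hF j) (h.summand j),
      h.pairwise_disjoint_summands, fun j ↦ iUnion_subset fun v ↦ subset_iUnion β ⟨j, v⟩⟩

lemma exists_four_carriesTernaryTree_of_mem_famA (hH : H ∈ famA (2 * k + 1))
    (h : IsMinorModel H.graph G β) : ∃ X : Fin 4 → Set V, (∀ i, CarriesTernaryTree G k (X i)) ∧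
      Pairwise (Disjoint on X) := by
  rw [famA_two_mul_add_one] at hH
  obtain ⟨F, hF, rfl⟩ := hH
  choose X hX hXX hsub using fun j ↦
    exists_two_carriesTernaryTree_of_mem_famA (hF j) (h.summand j)
  have hdisj : Pairwise (Disjoint on fun ij : Fin 2 × Fin 2 ↦ X ij.1 ij.2) := by
    rintro ⟨i, j⟩ ⟨i', j'⟩ hne
    by_cases hi : i = i'
    · subst hi
      exact hXX i fun hj ↦ hne (Prod.ext rfl hj)
    · exact (h.pairwise_disjoint_summands hi).mono (hsub i j) (hsub i' j')
  exact ⟨_, fun _ ↦ hX _ _, hdisj.comp_of_injective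
    (finProdFinEquiv (m := 2) (n := 2)).symm.injective⟩

theorem IsOuterplanar.le_ediam (hG : IsOuterplanar G) {D : ℕ} (hH : H ∈ famA D ∪ famB D)
    (h : IsMinor H.graph G) : ((D + 1 : ℕ) : ℕ∞) ≤ G.ediam := by
  obtain ⟨_, hG⟩ := hG.exists_nonCrossing
  obtain ⟨β, hβ⟩ := h.exists_isMinorModel
  obtain ⟨k, rfl | rfl⟩ := Nat.even_or_odd' D
  · rw [famB_two_mul, union_empty] at hH
    obtain ⟨X, hX, hXX, -⟩ := exists_two_carriesTernaryTree_of_mem_famA hH hβ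
    exact hG.le_ediam_of_disjoint (hX 0) (hX 1) (hXX (by decide))
  · rcases hH with hA | hB
    · obtain ⟨X, hX, hXX⟩ := exists_four_carriesTernaryTree_of_mem_famA hA hβ
      exact hG.le_ediam_of_pairwise_disjoint hX hXX
    · exact hG.le_ediam_of_carries_succ (carriesTernaryTree_of_mem_famB hB hβ)

end Families

end OPDI

theorem mainTheorem6_general (D : ℕ) {V : Type*} {G : SimpleGraph V} {H : OPDI.Gr}
    (hH : H ∈ OPDI.famA D ∪ OPDI.famB D) (h : OPDI.IsMinor H.graph G) :
    (OPDI.IsOuterplanar G → ((D + 1 : ℕ) : ℕ∞) ≤ G.ediam) ∧ (D : ℕ∞) < OPDI.opdi G := by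
  have hlt : (D : ℕ∞) < (D + 1 : ℕ) := by exact_mod_cast D.lt_succ_self
  refine ⟨fun hG ↦ hG.le_ediam hH h, hlt.trans_le (le_sInf ?_)⟩
  rintro _ ⟨G', hGG', hG', rfl⟩
  exact hG'.le_ediam hH (h.mono hGG')

theorem mainTheorem6 (D : ℕ) :
    (∀ {V : Type*} [Finite V] (G : SimpleGraph V), OPDI.IsOuterplanar G →
      (∃ H ∈ OPDI.famA D ∪ OPDI.famB D, OPDI.IsMinor H.graph G) →
        ((D + 1 : ℕ) : ℕ∞) ≤ G.ediam ∧ (D : ℕ∞) < OPDI.opdi G) ∧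
    (∀ H ∈ OPDI.famA D ∪ OPDI.famB D, (D : ℕ∞) < OPDI.opdi H.graph) :=
  ⟨fun _ hG ⟨_, hH, h⟩ ↦ (mainTheorem6_general D hH h).imp_left (· hG),
    fun H hH ↦ (mainTheorem6_general D hH (OPDI.isMinor_refl H.graph)).2⟩
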